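/- Let $K$ be a field, let $s\ge 2$, and let $S=K[t_1,\ldots,t_s]$ with the standard grading. Let $I\subset S$ be a graded ideal and let $\prec$ be a graded monomial order on $S$ (monomials are compared first by total degree). Let ${\rm in}_\prec(I)$ be the initial ideal of $I$. Conventions. An ideal $J\subset S$ is a complete intersection if it can be generated by $r$ elements, where $r$ is the height of $J$. The Hilbert function of $S/J$ is $H_J(d)=\dim_K(S_d/(J\cap S_d))$. If $k=\dim(S/J)$ is the Krull dimension, then $\deg(S/J)=(k-1)!\lim_{d\to\infty}H_J(d)/d^{k-1}$ for $k\ge 1$, and $\deg(S/J)=\dim_K(S/J)$ for $k=0$. The regularity ${\rm reg}(S/J)$ is the least integer $r\ge 0$ such that $H_J(d)$ equals the Hilbert polynomial of $S/J$ at $d$ for all $d\ge r$. An element $f\in S$ is a zero-divisor of $S/J$ if $(J\colon f)\ne J$. A monomial is standard if it does not lie in ${\rm in}_\prec(I)$. For $d\ge 1$, let $\mathcal{M}_d$ be the set of standard monomials of degree $d$ that are zero-divisors of $S/{\rm in}_\prec(I)$, and let $\mathcal{F}_d$ be the set of nonzero $K$-linear combinations of standard monomials of degree $d$ that are zero-divisors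 of $S/I$. The footprint function and the minimum distance function of $I$ are $${\rm fp}_I(d)=\deg(S/I)-\max\{\deg(S/({\rm in}_\prec(I),t^a)) : t^a\in\mathcal{M}_d\},\qquad \delta_I(d)=\deg(S/I)-\max\{\deg(S/(I,f)) : f\in\mathcal{F}_d\},$$ where ${\rm fp}_I(d)=\deg(S/I)$ if $\mathcal{M}_d=\emptyset$, and $\delta_I(d)=\deg(S/I)$ if $\mathcal{F}_d=\emptyset$. Proposition. Suppose that ${\rm in}_\prec(I)$ has height $s-1$ and is generated by $s-1$ monomials $t^{\alpha_2},\ldots,t^{\alpha_s}$ (so that it is a complete intersection), and let $d_i=\deg(t^{\alpha_i})$, with $d_i\ge 1$ for all $i$. Then: (a) $I$ is a complete intersection and $\dim(S/I)=1$. (b) $\deg(S/I)=d_2\cdots d_s$ and ${\rm reg}(S/I)=\sum_{i=2}^s(d_i-1)$. (c) For every $d\ge 1$, all the degrees and maxima in the definitions of ${\rm fp}_I(d)$ and $\delta_I(d)$ exist, and $1\le {\rm fp}_I(d)\le\delta_I(d)$. -/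

import Mathlib

open MvPolynomial Filter Topology

noncomputable section

namespace FootprintCI

variable {K : Type*} [Field K] {s : ℕ}

/-- The ideal `J` is graded for the standard grading: it contains the homogeneous components of
its elements. -/
def IsGraded (J : Ideal (MvPolynomial (Fin s) K)) : Prop :=
  ∀ f ∈ J, ∀ n : ℕ, homogeneousComponent n f ∈ J

/-- A monomial order is graded when it compares monomials first by total degree. -/
def IsGradedOrder (m : MonomialOrder (Fin s)) : Prop :=
  ∀ a b : Fin s →₀ ℕ, a.degree < b.degree → m.toSyn a < m.toSyn b

/-- The ideal generated by the leading monomials of the nonzero elements of `I`. -/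
def initialIdeal (m : MonomialOrder (Fin s)) (I : Ideal (MvPolynomial (Fin s) K)) :
    Ideal (MvPolynomial (Fin s) K) :=
  Ideal.span {u | ∃ f ∈ I, f ≠ 0 ∧ u = monomial (m.degree f) 1}

/-- `J` is generated by as many elements as its height. -/
def IsCompleteIntersection (J : Ideal (MvPolynomial (Fin s) K)) : Prop :=
  ∃ (r : ℕ) (g : Fin r → MvPolynomial (Fin s) K),
    J = Ideal.span (Set.range g) ∧ J.height = (r : ℕ∞)

/-- The Hilbert function `d ↦ dim_K (S_d / J_d)`, where `J_d = J ∩ S_d`. -/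
def hilbertFunction (J : Ideal (MvPolynomial (Fin s) K)) (d : ℕ) : ℕ :=
  Module.finrank K (homogeneousSubmodule (Fin s) K d ⧸
    (J.restrictScalars K).comap (homogeneousSubmodule (Fin s) K d).subtype)

/-- `e` is the degree (multiplicity) of `S / J`: if `k` is the Krull dimension of `S / J`, then
`e` is `(k - 1)! * lim H_J(d) / d ^ (k - 1)` for `k ≥ 1` and `dim_K (S / J)` for `k = 0`.
The existence of the limit is part of this predicate. -/
def HasDegree (J : Ideal (MvPolynomial (Fin s) K)) (e : ℕ) : Prop :=
  (ringKrullDim (MvPolynomial (Fin s) K ⧸ J) = 0 ∧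
      e = Module.finrank K (MvPolynomial (Fin s) K ⧸ J)) ∨
  ∃ k : ℕ, ringKrullDim (MvPolynomial (Fin s) K ⧸ J) = ((k + 1 : ℕ) : WithBot ℕ∞) ∧
    Tendsto (fun d : ℕ => (k.factorial : ℝ) * ((hilbertFunction J d : ℝ) / (d : ℝ) ^ k))
      atTop (𝓝 (e : ℝ))

open Classical in
/-- The degree of `S / J`; the value `0` is used only if there is no degree in the sense of
`HasDegree`. -/
def degree (J : Ideal (MvPolynomial (Fin s) K)) : ℕ :=
  if h : ∃ e, HasDegree J e then h.choose else 0

theorem HasDegree.unique {J : Ideal (MvPolynomial (Fin s) K)} {e e' : ℕ}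
    (h : HasDegree J e) (h' : HasDegree J e') : e = e' := by
  rcases h with ⟨h0, h1⟩ | ⟨k, hk, h1⟩ <;> rcases h' with ⟨h0', h1'⟩ | ⟨k', hk', h1'⟩
  · exact h1.trans h1'.symm
  · rw [h0] at hk'
    have : (0 : ℕ) = k' + 1 := by exact_mod_cast hk'
    omega
  · rw [h0'] at hk
    have : (0 : ℕ) = k + 1 := by exact_mod_cast hk
    omega
  · rw [hk] at hk'
    have h2 : k + 1 = k' + 1 := by exact_mod_cast hk'
    obtain rfl : k = k' := by omega
    exact_mod_cast tendsto_nhds_unique h1 h1'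

theorem HasDegree.degree_eq {J : Ideal (MvPolynomial (Fin s) K)} {e : ℕ}
    (h : HasDegree J e) : degree J = e := by
  have hex : ∃ e, HasDegree J e := ⟨e, h⟩
  rw [degree, dif_pos hex]
  exact hex.choose_spec.unique h

/-- `r` is the regularity of (the Hilbert function of) `S / J`: there is a Hilbert polynomial `h`,
that is, a polynomial agreeing with the Hilbert function for all large `d`, and `r` is the least
natural number such that the two agree for all `d ≥ r`. -/
def HasRegularity (J : Ideal (MvPolynomial (Fin s) K)) (r : ℕ) : Prop :=
  ∃ h : Polynomial ℚ, (∀ᶠ d : ℕ in atTop, (hilbertFunction J d : ℚ) = h.eval (d : ℚ)) ∧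
    IsLeast {n : ℕ | ∀ d : ℕ, n ≤ d → (hilbertFunction J d : ℚ) = h.eval (d : ℚ)} r

/-- `f` is a zero-divisor of `S / J`, that is, `(J : f) ≠ J`. -/
def IsZeroDivisorMod (J : Ideal (MvPolynomial (Fin s) K)) (f : MvPolynomial (Fin s) K) : Prop :=
  ∃ h : MvPolynomial (Fin s) K, h ∉ J ∧ h * f ∈ J

/-- The exponents of the standard monomials of `S / I`. -/
def footprint (m : MonomialOrder (Fin s)) (I : Ideal (MvPolynomial (Fin s) K)) :
    Set (Fin s →₀ ℕ) :=
  {a | (monomial a 1 : MvPolynomial (Fin s) K) ∉ initialIdeal m I}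

/-- The exponents of the standard monomials of degree `d` that are zero-divisors of
`S / in(I)`. -/
def standardZeroDivMonomials (m : MonomialOrder (Fin s)) (I : Ideal (MvPolynomial (Fin s) K))
    (d : ℕ) : Set (Fin s →₀ ℕ) :=
  {a | a ∈ footprint m I ∧ a.degree = d ∧ IsZeroDivisorMod (initialIdeal m I) (monomial a 1)}

/-- The nonzero `K`-linear combinations of standard monomials of degree `d` that are
zero-divisors of `S / I`. -/
def standardZeroDivPolys (m : MonomialOrder (Fin s)) (I : Ideal (MvPolynomial (Fin s) K))
    (d : ℕ) : Set (MvPolynomial (Fin s) K) :=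
  {f | f ≠ 0 ∧ (∀ a ∈ f.support, a ∈ footprint m I ∧ a.degree = d) ∧ IsZeroDivisorMod I f}

/-- The degrees of `S / (in(I), t^a)` over which the footprint function takes the maximum. -/
def footprintDegrees (m : MonomialOrder (Fin s)) (I : Ideal (MvPolynomial (Fin s) K))
    (d : ℕ) : Set ℕ :=
  {e | ∃ a ∈ standardZeroDivMonomials m I d,
    e = degree (initialIdeal m I ⊔ Ideal.span {monomial a 1})}

/-- The degrees of `S / (I, f)` over which the minimum distance function takes the maximum. -/
def minDistDegrees (m : MonomialOrder (Fin s)) (I : Ideal (MvPolynomial (Fin s) K))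
    (d : ℕ) : Set ℕ :=
  {e | ∃ f ∈ standardZeroDivPolys m I d, e = degree (I ⊔ Ideal.span {f})}

open Classical in
/-- The footprint function `fp_I`. -/
def fp (m : MonomialOrder (Fin s)) (I : Ideal (MvPolynomial (Fin s) K)) (d : ℕ) : ℤ :=
  if (standardZeroDivMonomials m I d).Nonempty then
    (degree I : ℤ) - ((sSup (footprintDegrees m I d) : ℕ) : ℤ)
  else (degree I : ℤ)

open Classical in
/-- The minimum distance function `δ_I`. -/
def minDist (m : MonomialOrder (Fin s)) (I : Ideal (MvPolynomial (Fin s) K)) (d : ℕ) : ℤ :=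
  if (standardZeroDivPolys m I d).Nonempty then
    (degree I : ℤ) - ((sSup (minDistDegrees m I d) : ℕ) : ℤ)
  else (degree I : ℤ)

end FootprintCI

end

namespace FootprintCI

/-! Since s - 1 monomials generate an ideal of height s - 1, they are pairwise coprime: a variable
shared by two of them would put in(I) inside an ideal generated by fewer than s - 1 variables,
against Krull's height theorem. By Macaulay, H_I(n) counts the monomials of degree n divisible by no
t^α_i, and coprimality gives the Hilbert series ∏(1 - X^d_i)/(1 - X)^s = ∏(1 + ... + X^(d_i - 1))/(1
- X). So H_I(n) is a partial sum of the coefficients of a monic polynomial of degree ∑(d_i - 1)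
whose value at 1 is ∏ d_i; this is (b).

For (a), lift the t^α_i to f_i in I with these leading monomials. By division the f_i generate I,
and coprime leading terms make them a regular sequence (`mem_span_of_mul_mem_span`), which bounds
the height below and the dimension above. Krull bounds the height above, and the infinitely many
standard monomials exclude dimension 0.

For (c), let f be a homogeneous zero-divisor outside I. Multiplication by f is not injective on S/I
in arbitrarily high degrees, where H_I is constant; so it is not surjective there, and S/(I,f) has
dimension 1. Its Hilbert function is eventually constant, and strictly below that of S/I because
multiples of f survive in S/I in high degrees. The same argument applies to in(I) and a monomial,
whence fp ≥ 1. Finally in(f) is a zero-divisor modulo in(I), and (in(I), in(f)) lies in in(I,f), so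
deg S/(I,f) ≤ deg S/(in(I), in(f)), whence fp ≤ δ. -/

/-- The exponents that are not the degree of a nonzero element of `J`. -/
def standardExponents {K : Type*} [Field K] {s : ℕ} (m : MonomialOrder (Fin s))
    (J : Ideal (MvPolynomial (Fin s) K)) : Set (Fin s →₀ ℕ) :=
  {u | ∀ p ∈ J, p ≠ 0 → m.degree p ≠ u}

/-! ### Standard monomials and Macaulay's theorem -/

section Standard

variable {K : Type*} [Field K] {s : ℕ} {m : MonomialOrder (Fin s)}
  {J J' : Ideal (MvPolynomial (Fin s) K)}

theorem not_mem_standardExponents {p : MvPolynomial (Fin s) K} (hp : p ∈ J) (h0 : p ≠ 0)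
    {u : Fin s →₀ ℕ} (hu : m.degree p ≤ u) : u ∉ standardExponents m J := by
  intro h
  have hmon : (monomial (u - m.degree p) (1 : K)) ≠ 0 := by simp
  refine h (monomial (u - m.degree p) 1 * p) (J.mul_mem_left _ hp) (mul_ne_zero hmon h0) ?_
  classical
  rw [MonomialOrder.degree_mul hmon h0, MonomialOrder.degree_monomial, if_neg one_ne_zero]
  exact tsub_add_cancel_of_le hu

theorem standardExponents_antitone (h : J ≤ J') :
    standardExponents m J' ⊆ standardExponents m J :=
  fun _ hu p hp => hu p (h hp)

theorem isLowerSet_standardExponents : IsLowerSet (standardExponents m J) := by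
  intro u v hvu hu
  by_contra hv
  simp only [standardExponents, Set.mem_ofPred_eq, not_forall, not_not] at hv
  obtain ⟨p, hp, h0, rfl⟩ := hv
  exact not_mem_standardExponents hp h0 hvu hu

theorem eq_zero_of_mem_of_support {p : MvPolynomial (Fin s) K} (hp : p ∈ J)
    (h : ∀ u ∈ p.support, u ∈ standardExponents m J) : p = 0 := by
  by_contra h0
  exact h _ (m.degree_mem_support h0) p hp h0 rfl

/-- Every polynomial is congruent to a combination of standard monomials. -/
theorem exists_normalForm (m : MonomialOrder (Fin s)) (J : Ideal (MvPolynomial (Fin s) K))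
    (f : MvPolynomial (Fin s) K) :
    ∃ r, f - r ∈ J ∧ ∀ u ∈ r.support, u ∈ standardExponents m J := by
  -- Dividing by all nonzero elements of `J` at once makes the remainder standard, with no Gröbner
  -- basis chosen.
  obtain ⟨g, r, hf, -, hr⟩ := m.div_set (B := {p | p ∈ J ∧ p ≠ 0})
    (fun b hb => (m.leadingCoeff_ne_zero_iff.mpr hb.2).isUnit) f
  refine ⟨r, ?_, fun u hu p hp h0 hpu => hr u hu p ⟨hp, h0⟩ hpu.le⟩
  rw [hf, add_sub_cancel_right, Finsupp.linearCombination_apply]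
  exact J.sum_mem fun b _ => J.mul_mem_left _ b.2.1

theorem monomial_mem_initialIdeal_iff {u : Fin s →₀ ℕ} :
    (monomial u 1 : MvPolynomial (Fin s) K) ∈ initialIdeal m J ↔ u ∉ standardExponents m J := by
  have : {v : MvPolynomial (Fin s) K | ∃ f ∈ J, f ≠ 0 ∧ v = monomial (m.degree f) 1} =
      (fun a => monomial a (1 : K)) '' {a | ∃ f ∈ J, f ≠ 0 ∧ a = m.degree f} := by
    ext v
    constructor
    · rintro ⟨f, hf, h0, rfl⟩
      exact ⟨_, ⟨f, hf, h0, rfl⟩, rfl⟩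
    · rintro ⟨_, ⟨f, hf, h0, rfl⟩, rfl⟩
      exact ⟨f, hf, h0, rfl⟩
  rw [initialIdeal, this, mem_ideal_span_monomial_image]
  simp only [mem_support_iff, coeff_monomial, ne_eq, ite_eq_right_iff, one_ne_zero, imp_false,
    not_not, forall_eq']
  constructor
  · rintro ⟨_, ⟨f, hf, h0, rfl⟩, h⟩
    exact not_mem_standardExponents hf h0 h
  · intro hu
    simp only [standardExponents, Set.mem_ofPred_eq, not_forall, not_not] at hu
    obtain ⟨p, hp, h0, rfl⟩ := hu
    exact ⟨_, ⟨p, hp, h0, rfl⟩, le_rfl⟩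

theorem footprint_eq : footprint m J = standardExponents m J := by
  ext u
  simp [footprint, monomial_mem_initialIdeal_iff]

theorem mem_span_monomial_iff {ι : Type*} {α : ι → Fin s →₀ ℕ} {p : MvPolynomial (Fin s) K} :
    p ∈ Ideal.span (Set.range fun i => (monomial (α i) 1 : MvPolynomial (Fin s) K)) ↔
      ∀ u ∈ p.support, ∃ i, α i ≤ u := by
  have : (Set.range fun i => (monomial (α i) 1 : MvPolynomial (Fin s) K)) =
      (fun a => monomial a (1 : K)) '' Set.range α := by
    rw [← Set.range_comp]; rfl
  rw [this, mem_ideal_span_monomial_image]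
  simp

theorem monomial_mem_span_monomial_iff {ι : Type*} {α : ι → Fin s →₀ ℕ} {u : Fin s →₀ ℕ} :
    (monomial u 1 : MvPolynomial (Fin s) K) ∈
      Ideal.span (Set.range fun i => (monomial (α i) 1 : MvPolynomial (Fin s) K)) ↔
      ∃ i, α i ≤ u := by
  classical
  rw [mem_span_monomial_iff, support_monomial, if_neg one_ne_zero]
  simp

/-- The exponents of the monomials outside the ideal generated by the monomials `t ^ α i`. -/
def avoid {σ ι : Type*} (α : ι → σ →₀ ℕ) : Set (σ →₀ ℕ) := {u | ∀ i, ¬ α i ≤ u}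

theorem standardExponents_span_monomial {ι : Type*} (α : ι → Fin s →₀ ℕ) :
    standardExponents m
      (Ideal.span (Set.range fun i => (monomial (α i) 1 : MvPolynomial (Fin s) K))) =
      avoid α := by
  classical
  ext u
  constructor
  · intro hu i hi
    have hmem : (monomial (α i) 1 : MvPolynomial (Fin s) K) ∈ Ideal.span
        (Set.range fun i => (monomial (α i) 1 : MvPolynomial (Fin s) K)) :=
      Ideal.subset_span ⟨i, rfl⟩
    refine not_mem_standardExponents hmem (by simp) ?_ hu
    rwa [MonomialOrder.degree_monomial, if_neg one_ne_zero]
  · rintro hu p hp h0 rfl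
    obtain ⟨i, hi⟩ := mem_span_monomial_iff.mp hp _ (m.degree_mem_support h0)
    exact hu i hi

theorem isGraded_span_monomial {ι : Type*} (α : ι → Fin s →₀ ℕ) :
    IsGraded (Ideal.span (Set.range fun i => (monomial (α i) 1 : MvPolynomial (Fin s) K))) := by
  intro f hf n
  rw [mem_span_monomial_iff] at hf ⊢
  intro u hu
  refine hf u ?_
  rw [mem_support_iff, coeff_homogeneousComponent] at hu
  rw [mem_support_iff]
  exact fun h => hu (by simp [h])

theorem linearIndependent_standard (m : MonomialOrder (Fin s))
    (J : Ideal (MvPolynomial (Fin s) K)) :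
    LinearIndependent K (fun u : standardExponents m J =>
      Ideal.Quotient.mkₐ K J (monomial (u : Fin s →₀ ℕ) 1)) := by
  rw [linearIndependent_iff]
  intro c hc
  have h1 : Finsupp.linearCombination K
      (fun u : standardExponents m J => (monomial (u : Fin s →₀ ℕ) (1 : K))) c ∈ J := by
    rw [← Ideal.Quotient.eq_zero_iff_mem, ← Ideal.Quotient.mkₐ_eq_mk K]
    rw [← hc, ← AlgHom.toLinearMap_apply, Finsupp.linearCombination_apply,
      Finsupp.linearCombination_apply, map_finsuppSum]
    simp
  have hcoeff : ∀ u : Fin s →₀ ℕ, coeff u (Finsupp.linearCombination K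
      (fun u : standardExponents m J => (monomial (u : Fin s →₀ ℕ) (1 : K))) c) =
      c.sum fun v a => if (v : Fin s →₀ ℕ) = u then a else 0 := by
    intro u
    rw [Finsupp.linearCombination_apply, Finsupp.sum, coeff_sum]
    refine Finset.sum_congr rfl fun v _ => ?_
    simp [coeff_smul, coeff_monomial]
  have h2 := eq_zero_of_mem_of_support h1 (m := m) (by
    intro u hu
    by_contra hns
    rw [mem_support_iff, hcoeff] at hu
    refine hu (Finset.sum_eq_zero fun v _ => if_neg ?_)
    rintro rfl
    exact hns v.2)
  ext v
  have := hcoeff v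
  rw [h2, coeff_zero] at this
  rw [Finsupp.coe_zero, Pi.zero_apply, this, Finsupp.sum]
  classical
  by_cases hv : v ∈ c.support
  · rw [Finset.sum_eq_single_of_mem v hv]
    · simp
    · intro w _ hw
      rw [if_neg]
      exact fun h => hw (Subtype.ext h)
  · rw [Finset.sum_eq_zero]
    · simpa using hv
    · intro w hw
      rw [if_neg]
      exact fun h => hv (Subtype.ext h ▸ hw)

/-- Every homogeneous polynomial is congruent modulo a graded ideal to a combination of standard
monomials of the same degree. -/
theorem exists_homogeneous_normalForm (m : MonomialOrder (Fin s)) (hJ : IsGraded J)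
    {f : MvPolynomial (Fin s) K} {n : ℕ} (hf : f.IsHomogeneous n) :
    ∃ g, g.IsHomogeneous n ∧ f - g ∈ J ∧
      ∀ u ∈ g.support, u ∈ standardExponents m J ∧ u.degree = n := by
  obtain ⟨r, hr, hsupp⟩ := exists_normalForm m J f
  -- The remainder need not be homogeneous; its component of degree `n` serves, as `J` is graded.
  have hr' := hJ _ hr n
  rw [map_sub, homogeneousComponent_eq_self hf] at hr'
  refine ⟨_, homogeneousComponent_isHomogeneous n r, hr', fun u hu => ?_⟩
  rw [mem_support_iff, coeff_homogeneousComponent] at hu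
  refine ⟨hsupp u ?_, ?_⟩
  · rw [mem_support_iff]; exact fun h => hu (by simp [h])
  · by_contra h; exact hu (by simp [h])

/-- Macaulay: the Hilbert function of a graded ideal counts the standard monomials. -/
theorem hilbertFunction_eq_card (m : MonomialOrder (Fin s)) (hJ : IsGraded J) (n : ℕ) :
    hilbertFunction J n = Nat.card {u // u ∈ standardExponents m J ∧ u.degree = n} := by
  set W := homogeneousSubmodule (Fin s) K n
  set N := (J.restrictScalars K).comap W.subtype
  let v : {u // u ∈ standardExponents m J ∧ u.degree = n} → W ⧸ N := fun u =>
    N.mkQ ⟨monomial u.1 1, isHomogeneous_monomial 1 u.2.2⟩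
  have hli : LinearIndependent K v := by
    let φ : W ⧸ N →ₗ[K] MvPolynomial (Fin s) K ⧸ J :=
      N.liftQ ((Ideal.Quotient.mkₐ K J).toLinearMap ∘ₗ W.subtype) (by
        intro x hx
        simpa using Ideal.Quotient.eq_zero_iff_mem.mpr hx)
    have := (linearIndependent_standard m J).comp
      (fun u : {u // u ∈ standardExponents m J ∧ u.degree = n} =>
        (⟨u.1, u.2.1⟩ : standardExponents m J))
      (fun a b h => Subtype.ext (by simpa using h))
    exact LinearIndependent.of_comp φ this
  have hsp : ⊤ ≤ Submodule.span K (Set.range v) := by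
    rintro x -
    obtain ⟨⟨f, hf⟩, rfl⟩ := N.mkQ_surjective x
    obtain ⟨g, hgh, hr', hgs⟩ := exists_homogeneous_normalForm m hJ hf
    have e1 : N.mkQ ⟨f, hf⟩ = N.mkQ ⟨g, hgh⟩ := by
      rw [← sub_eq_zero, ← map_sub]
      exact (Submodule.Quotient.mk_eq_zero N).mpr hr'
    have e2 : (⟨g, hgh⟩ : W) = ∑ u ∈ g.support.attach,
        coeff u.1 g • ⟨monomial u.1 1, isHomogeneous_monomial 1 (hgs u.1 u.2).2⟩ := by
      apply Subtype.ext
      rw [AddSubmonoidClass.coe_finsetSum]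
      simp only [Submodule.coe_smul, smul_monomial, smul_eq_mul, mul_one]
      rw [Finset.sum_attach g.support (fun u => monomial u (coeff u g))]
      exact g.as_sum
    rw [e1, e2, map_sum]
    refine Submodule.sum_mem _ fun u _ => ?_
    rw [map_smul]
    exact Submodule.smul_mem _ _ (Submodule.subset_span ⟨⟨u.1, hgs u.1 u.2⟩, rfl⟩)
  exact Module.finrank_eq_nat_card_basis (Module.Basis.mk hli hsp)

/-- Infinitely many standard monomials force positive Krull dimension. -/
theorem one_le_ringKrullDim_quotient (h : (standardExponents m J).Infinite) :
    1 ≤ ringKrullDim (MvPolynomial (Fin s) K ⧸ J) := by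
  have hnf : ¬ Module.Finite K (MvPolynomial (Fin s) K ⧸ J) := by
    intro hfin
    have := (linearIndependent_standard m J).finite
    exact h this
  have hnt : Nontrivial (MvPolynomial (Fin s) K ⧸ J) := by
    by_contra hs
    rw [not_nontrivial_iff_subsingleton] at hs
    exact hnf inferInstance
  rw [Module.finite_iff_krullDimLE_zero, ringKrullDimZero_iff_ringKrullDim_eq_zero] at hnf
  have h0 := ringKrullDim_nonneg_of_nontrivial (R := MvPolynomial (Fin s) K ⧸ J)
  exact Order.succ_le_of_lt (lt_of_le_of_ne h0 (Ne.symm hnf))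

theorem isGraded_sup_span_singleton (hJ : IsGraded J) {f : MvPolynomial (Fin s) K} {d : ℕ}
    (hf : f.IsHomogeneous d) : IsGraded (J ⊔ Ideal.span {f}) := by
  intro p hp n
  obtain ⟨a, ha, b, hb, rfl⟩ := Submodule.mem_sup.mp hp
  obtain ⟨c, rfl⟩ := Ideal.mem_span_singleton'.mp hb
  rw [map_add]
  refine add_mem (Ideal.mem_sup_left (hJ a ha n)) (Ideal.mem_sup_right ?_)
  have : c * f = ∑ i ∈ Finset.range (c.totalDegree + 1), homogeneousComponent i c * f := by
    rw [← Finset.sum_mul, sum_homogeneousComponent]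
  rw [this, map_sum]
  refine sum_mem fun i _ => ?_
  rw [homogeneousComponent_of_mem ((homogeneousComponent_isHomogeneous i c).mul hf)]
  split_ifs
  · exact Ideal.mul_mem_left _ _ (Ideal.mem_span_singleton_self f)
  · exact zero_mem _

end Standard
-- Counting monomials outside a monomial ideal
section Combinatorics

variable {σ ι : Type*} [Fintype σ] [Fintype ι] {α : ι → σ →₀ ℕ}

/-- If there are more variables than generators, then each monomial outside a monomial ideal
stays outside it after multiplication by a suitable variable. -/
theorem exists_add_single_mem_avoid (hcard : Fintype.card ι < Fintype.card σ) {u : σ →₀ ℕ}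
    (hu : u ∈ avoid α) : ∃ j, u + Finsupp.single j 1 ∈ avoid α := by
  classical
  by_contra! h
  have h' : ∀ j, ∃ i, α i ≤ u + Finsupp.single j 1 := by
    intro j
    by_contra! hj
    exact h j hj
  choose g hg using h'
  -- If one generator divides both t^u·t_j and t^u·t_k with j ≠ k, it divides t^u; so `g` would be
  -- injective.
  refine hcard.not_ge (Fintype.card_le_of_injective g fun j k hjk => ?_)
  by_contra hne
  refine hu (g j) fun x => ?_
  by_cases hx : x = j
  · have := hg k x
    rw [← hjk] at this
    simpa [hx, Finsupp.single_apply, Ne.symm hne] using this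
  · simpa [Finsupp.single_apply, Ne.symm hx] using hg j x

theorem exists_mem_avoid_degree_eq (hcard : Fintype.card ι < Fintype.card σ) {u : σ →₀ ℕ}
    (hu : u ∈ avoid α) (n : ℕ) : ∃ v, u ≤ v ∧ v ∈ avoid α ∧ v.degree = u.degree + n := by
  induction n with
  | zero => exact ⟨u, le_rfl, hu, rfl⟩
  | succ n ih =>
    obtain ⟨v, huv, hv, hd⟩ := ih
    obtain ⟨j, hj⟩ := exists_add_single_mem_avoid hcard hv
    refine ⟨_, huv.trans (by simp), hj, ?_⟩
    rw [map_add, Finsupp.degree_single, hd, add_assoc]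

/-- If the supports of the generators are disjoint and there are at least as many generators as
variables but one, then at most one exponent of a monomial outside the ideal is large. -/
theorem eq_of_le_of_mem_avoid (hdisj : ∀ i k, i ≠ k → ∀ j, α i j = 0 ∨ α k j = 0)
    (hcard : Fintype.card σ ≤ Fintype.card ι + 1) {M : ℕ} (hM : ∀ i j, α i j ≤ M)
    {u : σ →₀ ℕ} (hu : u ∈ avoid α) {j k : σ} (hj : M ≤ u j) (hk : M ≤ u k) : j = k := by
  classical
  by_contra hne
  have h : ∀ i, ∃ x, u x < α i x := by
    intro i
    by_contra! hi
    exact hu i hi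
  -- `v i` is a variable in which `u` falls short of `α i`. Disjoint supports make `v` injective,
  -- and its values miss `j` and `k`: too many generators for the remaining variables.
  choose v hv using h
  have hinj : Function.Injective v := by
    intro a b hab
    by_contra hab'
    have h1 := hv a
    have h2 := hv b
    rw [← hab] at h2
    rcases hdisj a b hab' (v a) with h | h <;> omega
  have hsub : Finset.univ.image v ⊆ (Finset.univ.erase j).erase k := by
    intro x hx
    obtain ⟨i, -, rfl⟩ := Finset.mem_image.mp hx
    simp only [Finset.mem_erase, Finset.mem_univ, and_true]
    constructor
    · rintro rfl
      have h1 := hM i (v i)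
      have h2 := hv i
      omega
    · rintro rfl
      have h1 := hM i (v i)
      have h2 := hv i
      omega
  have hc := Finset.card_le_card hsub
  rw [Finset.card_image_of_injective _ hinj, Finset.card_erase_of_mem (by simp [Ne.symm hne]),
    Finset.card_erase_of_mem (by simp), Finset.card_univ, Finset.card_univ] at hc
  have : 1 < Fintype.card σ := Fintype.one_lt_card_iff.mpr ⟨j, k, hne⟩
  omega

theorem finite_degree_eq (V : Set (σ →₀ ℕ)) (n : ℕ) : Finite {u // u ∈ V ∧ u.degree = n} :=
  ((Finsupp.finite_of_degree_eq n).subset fun _ hu => hu.2 :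
    {u : σ →₀ ℕ | u ∈ V ∧ u.degree = n}.Finite)

theorem card_degree_mono {V W : Set (σ →₀ ℕ)} (h : V ⊆ W) (n : ℕ) :
    Nat.card {u // u ∈ V ∧ u.degree = n} ≤ Nat.card {u // u ∈ W ∧ u.degree = n} := by
  have := finite_degree_eq W n
  refine Nat.card_le_card_of_injective (fun u => ⟨u.1, h u.2.1, u.2.2⟩) fun a b hab => ?_
  exact Subtype.ext (by simpa using hab)

theorem card_degree_lt {V W : Set (σ →₀ ℕ)} (h : V ⊆ W) {n : ℕ} {w : σ →₀ ℕ} (hw : w ∈ W)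
    (hwV : w ∉ V) (hn : w.degree = n) :
    Nat.card {u // u ∈ V ∧ u.degree = n} < Nat.card {u // u ∈ W ∧ u.degree = n} := by
  have hfin : {u : σ →₀ ℕ | u ∈ W ∧ u.degree = n}.Finite := finite_degree_eq W n
  exact Set.ncard_lt_ncard (s := {u : σ →₀ ℕ | u ∈ V ∧ u.degree = n})
    ⟨fun u hu => ⟨h hu.1, hu.2⟩, fun hs => hwV (hs ⟨hw, hn⟩).1⟩ hfin

/-- The number of monomials of degree `n` in a lower set avoiding a monomial complete
intersection of dimension one does not increase for large `n`. -/
theorem card_degree_succ_le (hdisj : ∀ i k, i ≠ k → ∀ j, α i j = 0 ∨ α k j = 0)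
    (hcard : Fintype.card σ ≤ Fintype.card ι + 1) {M : ℕ} (hM : ∀ i j, α i j ≤ M)
    {V : Set (σ →₀ ℕ)} (hV : IsLowerSet V) (hVα : V ⊆ avoid α) {n : ℕ}
    (hn : Fintype.card σ * M ≤ n) :
    Nat.card {u // u ∈ V ∧ u.degree = n + 1} ≤ Nat.card {u // u ∈ V ∧ u.degree = n} := by
  classical
  have hlarge : ∀ u : {u // u ∈ V ∧ u.degree = n + 1}, ∃ j, M + 1 ≤ u.1 j := by
    rintro ⟨u, hu, hd⟩
    by_contra! h
    have : u.degree ≤ ∑ _j : σ, M := by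
      rw [Finsupp.degree_eq_sum]
      exact Finset.sum_le_sum fun j _ => Nat.lt_succ_iff.mp (h j)
    rw [Finset.sum_const, Finset.card_univ, smul_eq_mul, hd] at this
    omega
  choose j hj using hlarge
  have hadd : ∀ u, u.1 - Finsupp.single (j u) 1 + Finsupp.single (j u) 1 = u.1 := by
    intro u
    refine tsub_add_cancel_of_le ?_
    rw [Finsupp.single_le_iff]
    have := hj u
    omega
  have hmem : ∀ u, u.1 - Finsupp.single (j u) 1 ∈ V := fun u => hV tsub_le_self u.2.1
  have := finite_degree_eq V n
  -- Lower the large exponent by one. It is still at least `M`, and only one exponent can be, so the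
  -- lowered variable can be recovered.
  refine Nat.card_le_card_of_injective
    (fun u => ⟨u.1 - Finsupp.single (j u) 1, hmem u, ?_⟩) fun a b hab => ?_
  · have h := congrArg Finsupp.degree (hadd u)
    rw [map_add, Finsupp.degree_single, u.2.2] at h
    omega
  · have hab' : a.1 - Finsupp.single (j a) 1 = b.1 - Finsupp.single (j b) 1 := by
      simpa using hab
    have hjab : j a = j b := by
      refine eq_of_le_of_mem_avoid hdisj hcard hM (hVα (hmem a)) ?_ ?_
      · have := hj a
        simp only [Finsupp.tsub_apply, Finsupp.single_eq_same]
        omega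
      · rw [hab']
        have := hj b
        simp only [Finsupp.tsub_apply, Finsupp.single_eq_same]
        omega
    apply Subtype.ext
    rw [← hadd a, ← hadd b, hab', hjab]

theorem exists_eventually_eq_of_succ_le {f : ℕ → ℕ} {N : ℕ} (h : ∀ n, N ≤ n → f (n + 1) ≤ f n) :
    ∃ e, ∀ᶠ n in atTop, f n = e := by
  have hanti : ∀ n k, N ≤ n → f (n + k) ≤ f n := by
    intro n k hn
    induction k with
    | zero => exact le_rfl
    | succ k ih => exact (h (n + k) (by omega)).trans ih
  obtain ⟨e, ⟨n₀, hn₀, rfl⟩, hmin⟩ := WellFounded.has_min (wellFounded_lt (α := ℕ))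
    (f '' {n | N ≤ n}) ⟨_, N, le_refl N, rfl⟩
  refine ⟨f n₀, eventually_atTop.mpr ⟨n₀, fun n hn => ?_⟩⟩
  obtain ⟨k, rfl⟩ := Nat.exists_eq_add_of_le hn
  refine le_antisymm (hanti n₀ k hn₀) (not_lt.mp (hmin _ ⟨n₀ + k, ?_, rfl⟩))
  exact le_trans hn₀ (Nat.le_add_right _ _)

/-- The number of monomials of degree `n` in a lower set avoiding a monomial complete
intersection of dimension one is eventually constant. -/
theorem exists_eventually_card_degree_eq (hdisj : ∀ i k, i ≠ k → ∀ j, α i j = 0 ∨ α k j = 0)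
    (hcard : Fintype.card σ ≤ Fintype.card ι + 1) {V : Set (σ →₀ ℕ)} (hV : IsLowerSet V)
    (hVα : V ⊆ avoid α) :
    ∃ e, ∀ᶠ n in atTop, Nat.card {u // u ∈ V ∧ u.degree = n} = e := by
  refine exists_eventually_eq_of_succ_le (N := Fintype.card σ * ∑ i, ∑ j, α i j) fun n hn =>
    card_degree_succ_le hdisj hcard (fun i j => ?_) hV hVα hn
  exact (Finset.single_le_sum (f := fun j => α i j) (fun _ _ => Nat.zero_le _)
    (Finset.mem_univ j)).trans
    (Finset.single_le_sum (f := fun i => ∑ j, α i j) (fun _ _ => Nat.zero_le _)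
      (Finset.mem_univ i))

end Combinatorics

/-! ### Hilbert series of a monomial complete intersection -/

section HilbertSeries

open Finset PowerSeries

variable {σ ι : Type*} [Fintype σ] [DecidableEq σ]

theorem mem_finsuppAntidiag_univ {u : σ →₀ ℕ} {n : ℕ} :
    u ∈ finsuppAntidiag univ n ↔ u.degree = n := by
  simp [mem_finsuppAntidiag, Finsupp.degree_eq_sum]

open Classical in
/-- The number of monomials of degree `n` divisible by no `t ^ α i` with `i ∈ T`. -/
noncomputable def countAvoid (α : ι → σ →₀ ℕ) (T : Finset ι) (n : ℕ) : ℕ :=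
  #{u ∈ finsuppAntidiag univ n | ∀ i ∈ T, ¬ α i ≤ u}

/-- By coprimality, the monomials avoiding `T` that are divisible by t^α_k are exactly t^α_k times
the monomials avoiding `T`. -/
theorem countAvoid_insert [DecidableEq ι] {α : ι → σ →₀ ℕ}
    (hdisj : ∀ i k, i ≠ k → ∀ j, α i j = 0 ∨ α k j = 0) {T : Finset ι} {k : ι} (hk : k ∉ T)
    (n : ℕ) :
    countAvoid α T n = countAvoid α (insert k T) n +
      if (α k).degree ≤ n then countAvoid α T (n - (α k).degree) else 0 := by
  classical
  have hsplit := card_filter_add_card_filter_not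
    (s := {u ∈ finsuppAntidiag univ n | ∀ i ∈ T, ¬ α i ≤ u}) (fun u => ¬ α k ≤ u)
  rw [countAvoid, ← hsplit]
  congr 1
  · rw [countAvoid, filter_filter]
    congr 1
    ext u
    simp only [mem_filter, forall_mem_insert]
    tauto
  · have hadd : ∀ u : σ →₀ ℕ, (∀ i ∈ T, ¬ α i ≤ u + α k) ↔ ∀ i ∈ T, ¬ α i ≤ u := by
      intro u
      refine forall₂_congr fun i hi => not_congr ⟨fun h j => ?_, fun h => h.trans (by simp)⟩
      have hj := h j
      rcases hdisj i k (by rintro rfl; exact hk hi) j with h0 | h0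
      · simp [h0]
      · simpa [h0] using hj
    split_ifs with hd
    · rw [countAvoid]
      symm
      refine card_bij' (fun u _ => u + α k) (fun u _ => u - α k) ?_ ?_ ?_ ?_
      · intro u hu
        simp only [mem_filter, mem_finsuppAntidiag_univ, not_not] at hu ⊢
        refine ⟨⟨?_, (hadd u).mpr hu.2⟩, by simp⟩
        rw [map_add, hu.1]
        omega
      · intro u hu
        simp only [mem_filter, mem_finsuppAntidiag_univ, not_not] at hu ⊢
        have hc := tsub_add_cancel_of_le hu.2
        refine ⟨?_, ?_⟩
        · have := congrArg Finsupp.degree hc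
          rw [map_add, hu.1.1] at this
          omega
        · rw [← hadd, hc]
          exact hu.1.2
      · intro u _
        simp
      · intro u hu
        simp only [mem_filter, not_not] at hu
        exact tsub_add_cancel_of_le hu.2
    · rw [card_eq_zero, filter_eq_empty_iff]
      intro u hu
      simp only [mem_filter, mem_finsuppAntidiag_univ] at hu
      rw [not_not]
      intro hle
      have := Finsupp.degree_mono hle
      omega

/-- With no generators this is the series of all monomials; by `countAvoid_insert`, each new
generator contributes a factor 1 - X^d. -/
theorem mk_countAvoid_mul {α : ι → σ →₀ ℕ} [Nonempty σ]
    (hdisj : ∀ i k, i ≠ k → ∀ j, α i j = 0 ∨ α k j = 0) (T : Finset ι) :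
    (PowerSeries.mk fun n => (countAvoid α T n : ℤ)) * (1 - PowerSeries.X) ^ Fintype.card σ =
      ∏ i ∈ T, (1 - PowerSeries.X ^ (α i).degree) := by
  classical
  induction T using Finset.induction_on with
  | empty =>
    obtain ⟨c, hc⟩ := Nat.exists_eq_succ_of_ne_zero (Fintype.card_ne_zero (α := σ))
    rw [prod_empty, hc, Nat.succ_eq_add_one]
    refine Eq.trans ?_ (PowerSeries.mk_add_choose_mul_one_sub_pow_eq_one ℤ c)
    congr 2
    ext n
    rw [countAvoid]
    simp only [notMem_empty, IsEmpty.forall_iff, implies_true, filter_true,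
      card_finsuppAntidiag_nat_eq_choose, card_univ, hc]
    have : c.succ + n - 1 = c + n := by omega
    rw [this, Nat.choose_symm_add]
  | insert k T hk ih =>
    rw [prod_insert hk, ← ih, ← mul_assoc]
    congr 1
    ext n
    rw [sub_mul, one_mul, mul_comm, map_sub, PowerSeries.coeff_mul_X_pow']
    simp only [PowerSeries.coeff_mk]
    rw [countAvoid_insert hdisj hk n]
    split_ifs <;> push_cast <;> ring

/-- The numerator of the Hilbert series of a monomial complete intersection of dimension one. -/
noncomputable def geomProd [Fintype ι] (d : ι → ℕ) : Polynomial ℤ :=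
  ∏ i, ∑ j ∈ range (d i), Polynomial.X ^ j

variable [Fintype ι]

theorem countAvoid_univ_eq_sum_coeff {α : ι → σ →₀ ℕ}
    (hdisj : ∀ i k, i ≠ k → ∀ j, α i j = 0 ∨ α k j = 0)
    (hcard : Fintype.card σ = Fintype.card ι + 1) (n : ℕ) :
    (countAvoid α univ n : ℤ) = ∑ j ∈ range (n + 1), (geomProd fun i => (α i).degree).coeff j := by
  have : Nonempty σ := Fintype.card_pos_iff.mp (by omega)
  have h := mk_countAvoid_mul hdisj univ
  have h1 : ((1 : ℤ⟦X⟧) - PowerSeries.X) ≠ 0 := by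
    intro h0
    have := PowerSeries.mk_one_mul_one_sub_eq_one ℤ
    rw [h0, mul_zero] at this
    exact zero_ne_one this
  -- Each 1 - X^d is 1 - X times a geometric sum. Cancelling leaves a single 1 - X, whose inverse
  -- turns coefficients into partial sums.
  simp_rw [← mul_neg_geom_sum] at h
  rw [prod_mul_distrib, prod_const, card_univ, hcard, pow_succ', ← mul_assoc,
    mul_comm ((1 - PowerSeries.X) ^ Fintype.card ι)] at h
  have h2 := mul_right_cancel₀ (pow_ne_zero _ h1) h
  have h3 : ((geomProd fun i => (α i).degree : Polynomial ℤ) : ℤ⟦X⟧) =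
      ∏ i, ∑ j ∈ range (α i).degree, PowerSeries.X ^ j := by
    rw [geomProd, ← Polynomial.coeToPowerSeries.ringHom_apply, map_prod]
    simp
  have h4 : (PowerSeries.mk fun n => (countAvoid α univ n : ℤ)) =
      ((geomProd fun i => (α i).degree : Polynomial ℤ) : ℤ⟦X⟧) * PowerSeries.mk 1 := by
    rw [h3, ← h2, mul_assoc, mul_comm (1 - PowerSeries.X),
      PowerSeries.mk_one_mul_one_sub_eq_one, mul_one]
  have h5 := congrArg (PowerSeries.coeff n) h4
  rw [PowerSeries.coeff_mk, PowerSeries.coeff_mul,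
    Finset.Nat.sum_antidiagonal_eq_sum_range_succ_mk] at h5
  simpa using h5

theorem card_avoid_degree_eq (α : ι → σ →₀ ℕ) (n : ℕ) :
    Nat.card {u // u ∈ avoid α ∧ u.degree = n} = countAvoid α univ n := by
  refine Nat.subtype_card _ fun u => ?_
  rw [mem_filter, mem_finsuppAntidiag_univ]
  simp [avoid, and_comm]

theorem natDegree_geom_sum_X {n : ℕ} (hn : n ≠ 0) :
    (∑ i ∈ range n, (Polynomial.X : Polynomial ℤ) ^ i).natDegree = n - 1 := by
  obtain ⟨k, rfl⟩ := Nat.exists_eq_succ_of_ne_zero hn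
  rw [sum_range_succ, Polynomial.natDegree_add_eq_right_of_degree_lt]
  · simp
  · rw [Polynomial.degree_X_pow]
    refine (Polynomial.degree_sum_le _ _).trans_lt ?_
    rw [Finset.sup_lt_iff (by exact WithBot.bot_lt_coe k)]
    intro i hi
    rw [Polynomial.degree_X_pow]
    exact_mod_cast mem_range.mp hi

variable {d : ι → ℕ}

theorem monic_geomProd (hd : ∀ i, 1 ≤ d i) : (geomProd d).Monic :=
  Polynomial.monic_prod_of_monic _ _ fun i _ =>
    Polynomial.monic_geom_sum_X (Nat.one_le_iff_ne_zero.mp (hd i))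

theorem natDegree_geomProd (hd : ∀ i, 1 ≤ d i) : (geomProd d).natDegree = ∑ i, (d i - 1) := by
  rw [geomProd, Polynomial.natDegree_prod_of_monic]
  · exact sum_congr rfl fun i _ => natDegree_geom_sum_X (Nat.one_le_iff_ne_zero.mp (hd i))
  · exact fun i _ => Polynomial.monic_geom_sum_X (Nat.one_le_iff_ne_zero.mp (hd i))

theorem sum_coeff_geomProd (hd : ∀ i, 1 ≤ d i) {n : ℕ} (hn : ∑ i, (d i - 1) ≤ n) :
    ∑ j ∈ range (n + 1), (geomProd d).coeff j = ∏ i, (d i : ℤ) := by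
  have h := Polynomial.eval_eq_sum_range' (p := geomProd d) (n := n + 1)
    (by rw [natDegree_geomProd hd]; omega) 1
  simp only [one_pow, mul_one] at h
  rw [← h, geomProd, Polynomial.eval_prod]
  simp

/-- Only the leading coefficient, which is 1, is missing from the full sum. This makes the
regularity sharp. -/
theorem sum_coeff_geomProd_of_succ_eq (hd : ∀ i, 1 ≤ d i) {n : ℕ} (hn : n + 1 = ∑ i, (d i - 1)) :
    ∑ j ∈ range (n + 1), (geomProd d).coeff j = ∏ i, (d i : ℤ) - 1 := by
  rw [← sum_coeff_geomProd hd hn.ge, sum_range_succ _ (n + 1)]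
  have := monic_geomProd hd
  rw [Polynomial.Monic, Polynomial.leadingCoeff, natDegree_geomProd hd, ← hn] at this
  rw [this]
  ring

end HilbertSeries
-- Height and dimension after adding a nonzerodivisor
section NonZeroDivisor

variable {R : Type*} [CommRing R] {J : Ideal R} {f : R}

theorem height_add_one_le_height_sup_span_singleton (hf : ∀ h, h * f ∈ J → h ∈ J) :
    J.height + 1 ≤ (J ⊔ Ideal.span {f}).height := by
  rw [(J ⊔ Ideal.span {f}).height_eq_inf_minimalPrimes]
  refine le_iInf₂ fun p hp => ?_
  have := hp.isPrime
  obtain ⟨q, hq, hqp⟩ := Ideal.exists_minimalPrimes_le (le_sup_left.trans hp.le)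
  have := hq.isPrime
  have hfp : f ∈ p := hp.le (Ideal.mem_sup_right (Ideal.mem_span_singleton_self f))
  -- Elements of a minimal prime of `J` are zero-divisors modulo `J`.
  have hfq : f ∉ q := by
    intro hfq
    obtain ⟨y, hy, hfy⟩ := Ideal.exists_mul_mem_of_mem_minimalPrimes hq hfq
    exact hy (hf y (by rwa [mul_comm]))
  have hlt : q < p := lt_of_le_of_ne hqp (by rintro rfl; exact hfq hfp)
  calc J.height + 1 ≤ q.height + 1 := by gcongr; exact hq.le
    _ ≤ p.height := Ideal.height_add_one_le_of_lt_of_isPrime hlt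

theorem ringKrullDim_quotient_sup_span_singleton_add_one_le (hf : ∀ h, h * f ∈ J → h ∈ J) :
    ringKrullDim (R ⧸ J ⊔ Ideal.span {f}) + 1 ≤ ringKrullDim (R ⧸ J) := by
  refine ringKrullDim_succ_le_of_surjective
    (Ideal.Quotient.factor (le_sup_left : J ≤ J ⊔ Ideal.span {f}))
    (Ideal.Quotient.factor_surjective _) (r := Ideal.Quotient.mk J f) ?_ ?_
  · rw [mem_nonZeroDivisors_iff_right]
    intro x hx
    obtain ⟨h, rfl⟩ := Ideal.Quotient.mk_surjective x
    rw [← map_mul, Ideal.Quotient.eq_zero_iff_mem] at hx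
    exact Ideal.Quotient.eq_zero_iff_mem.mpr (hf h hx)
  · rw [Ideal.Quotient.factor_mk, Ideal.Quotient.eq_zero_iff_mem]
    exact Ideal.mem_sup_right (Ideal.mem_span_singleton_self f)

end NonZeroDivisor

/-! ### Coprime leading terms and regular sequences -/

section CoprimeLeadingTerms

variable {K : Type*} [Field K] {s : ℕ} {m : MonomialOrder (Fin s)} {ι : Type*}
  {f : ι → MvPolynomial (Fin s) K}

theorem le_of_le_add_of_disjoint {σ : Type*} {a b u : σ →₀ ℕ} (hdisj : ∀ j, a j = 0 ∨ b j = 0)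
    (h : a ≤ u + b) : a ≤ u := by
  intro j
  have hj := h j
  rcases hdisj j with h0 | h0
  · simp [h0]
  · simpa [h0] using hj

/-- Multiplying by an element whose leading term is coprime to those of `f i`, `i ∈ T`. -/
theorem exists_reduction (hf : ∀ i, f i ≠ 0)
    (hdisj : ∀ i k, i ≠ k → ∀ j, m.degree (f i) j = 0 ∨ m.degree (f k) j = 0)
    {T : Finset ι} {k : ι} (hk : k ∉ T) (h : MvPolynomial (Fin s) K) :
    ∃ r, h - r ∈ Ideal.span (f '' T) ∧
      (r ≠ 0 → ∀ i ∈ T, ¬ m.degree (f i) ≤ m.degree (r * f k)) := by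
  obtain ⟨r, hr, hs⟩ := exists_normalForm m (Ideal.span (f '' T)) h
  refine ⟨r, hr, fun h0 i hi hle => ?_⟩
  rw [MonomialOrder.degree_mul h0 (hf k)] at hle
  have hmem : f i ∈ Ideal.span (f '' T) := Ideal.subset_span (Set.mem_image_of_mem f hi)
  exact not_mem_standardExponents hmem (hf i)
    (le_of_le_add_of_disjoint (hdisj i k (by rintro rfl; exact hk hi)) hle)
    (hs _ (m.degree_mem_support h0))

/-- Polynomials with pairwise coprime leading terms form a Gröbner basis. -/
theorem exists_degree_le_of_mem_span (hf : ∀ i, f i ≠ 0)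
    (hdisj : ∀ i k, i ≠ k → ∀ j, m.degree (f i) j = 0 ∨ m.degree (f k) j = 0)
    (T : Finset ι) :
    ∀ p ∈ Ideal.span (f '' T), p ≠ 0 → ∃ i ∈ T, m.degree (f i) ≤ m.degree p := by
  classical
  induction T using Finset.induction_on with
  | empty =>
    intro p hp h0
    exact absurd (by simpa using hp) h0
  | insert k T hk ih =>
    intro p hp h0
    rw [Finset.coe_insert, Set.image_insert_eq, Ideal.span_insert] at hp
    obtain ⟨a, ha, q, hq, rfl⟩ := Submodule.mem_sup.mp hp
    obtain ⟨c, rfl⟩ := Ideal.mem_span_singleton'.mp ha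
    obtain ⟨r, hr, hrT⟩ := exists_reduction hf hdisj hk c
    have hq' : (c - r) * f k + q ∈ Ideal.span (f '' T) :=
      add_mem (Ideal.mul_mem_right _ _ hr) hq
    -- With `c` reduced to `r`, the leading terms of the two summands cannot cancel: that of `q'` is
    -- divisible by some in(f_i) with i in `T`, that of r·f_k by none.
    have he : c * f k + q = r * f k + ((c - r) * f k + q) := by ring
    rw [he] at h0 ⊢
    generalize (c - r) * f k + q = q' at hq' h0
    by_cases hr0 : r = 0
    · obtain ⟨i, hi, hle⟩ := ih q' hq' (by simpa [hr0] using h0)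
      exact ⟨i, Finset.mem_insert_of_mem hi, by simpa [hr0] using hle⟩
    have hlek : m.degree (f k) ≤ m.degree (r * f k) := by
      rw [MonomialOrder.degree_mul hr0 (hf k)]
      simp
    by_cases hq0 : q' = 0
    · exact ⟨k, Finset.mem_insert_self _ _, by simpa [hq0] using hlek⟩
    obtain ⟨i, hi, hle⟩ := ih q' hq' hq0
    rcases lt_trichotomy (m.toSyn (m.degree (r * f k))) (m.toSyn (m.degree q')) with h | h | h
    · rw [MonomialOrder.degree_add_eq_right_of_lt h]
      exact ⟨i, Finset.mem_insert_of_mem hi, hle⟩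
    · rw [← m.toSyn.injective h] at hle
      exact absurd hle (hrT hr0 i hi)
    · rw [MonomialOrder.degree_add_of_lt h]
      exact ⟨k, Finset.mem_insert_self _ _, hlek⟩

/-- Polynomials with pairwise coprime leading terms form a regular sequence. -/
theorem mem_span_of_mul_mem_span (hf : ∀ i, f i ≠ 0)
    (hdisj : ∀ i k, i ≠ k → ∀ j, m.degree (f i) j = 0 ∨ m.degree (f k) j = 0)
    {T : Finset ι} {k : ι} (hk : k ∉ T) (h : MvPolynomial (Fin s) K)
    (hh : h * f k ∈ Ideal.span (f '' T)) : h ∈ Ideal.span (f '' T) := by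
  obtain ⟨r, hr, hrT⟩ := exists_reduction hf hdisj hk h
  by_cases hr0 : r = 0
  · simpa [hr0] using hr
  have hmem : r * f k ∈ Ideal.span (f '' T) := by
    have := sub_mem hh (Ideal.mul_mem_right (f k) _ hr)
    rwa [sub_mul, sub_sub_cancel] at this
  obtain ⟨i, hi, hle⟩ := exists_degree_le_of_mem_span hf hdisj T _ hmem (mul_ne_zero hr0 (hf k))
  exact absurd hle (hrT hr0 i hi)

theorem card_le_height_span (hf : ∀ i, f i ≠ 0)
    (hdisj : ∀ i k, i ≠ k → ∀ j, m.degree (f i) j = 0 ∨ m.degree (f k) j = 0)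
    (T : Finset ι) : (T.card : ℕ∞) ≤ (Ideal.span (f '' T)).height := by
  classical
  induction T using Finset.induction_on with
  | empty => simp
  | insert k T hk ih =>
    have := height_add_one_le_height_sup_span_singleton (mem_span_of_mul_mem_span hf hdisj hk)
    rw [Finset.coe_insert, Set.image_insert_eq, Ideal.span_insert, sup_comm,
      Finset.card_insert_of_notMem hk]
    push_cast
    exact le_trans (by gcongr) this

theorem ringKrullDim_quotient_span_add_card_le (hf : ∀ i, f i ≠ 0)
    (hdisj : ∀ i k, i ≠ k → ∀ j, m.degree (f i) j = 0 ∨ m.degree (f k) j = 0)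
    (T : Finset ι) :
    ringKrullDim (MvPolynomial (Fin s) K ⧸ Ideal.span (f '' T)) + (T.card : ℕ) ≤ (s : ℕ) := by
  classical
  induction T using Finset.induction_on with
  | empty =>
    have h := ringKrullDim_quotient_le (Ideal.span (f '' (∅ : Finset ι)))
    rw [MvPolynomial.ringKrullDim_of_isNoetherianRing, ringKrullDim_eq_zero_of_field] at h
    rw [Finset.card_empty, Nat.cast_zero, add_zero]
    simpa using h
  | insert k T hk ih =>
    have := ringKrullDim_quotient_sup_span_singleton_add_one_le
      (mem_span_of_mul_mem_span hf hdisj hk)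
    rw [Finset.coe_insert, Set.image_insert_eq, Ideal.span_insert, sup_comm,
      Finset.card_insert_of_notMem hk]
    push_cast
    rw [add_comm (T.card : WithBot ℕ∞) 1, ← add_assoc]
    exact le_trans (by gcongr) ih

end CoprimeLeadingTerms

/-- If `n` monomials generate an ideal of height `n`, then their supports are disjoint. -/
theorem disjoint_of_height_eq {K : Type*} [Field K] {s : ℕ} {ι : Type*} [Fintype ι]
    {α : ι → Fin s →₀ ℕ} (hα : ∀ i, 1 ≤ (α i).degree)
    (hht : (Ideal.span (Set.range fun i => (monomial (α i) 1 : MvPolynomial (Fin s) K))).height =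
      (Fintype.card ι : ℕ∞)) (i k : ι) (hik : i ≠ k) (j : Fin s) : α i j = 0 ∨ α k j = 0 := by
  classical
  by_contra! hj
  have hex : ∀ l, ∃ x, α l x ≠ 0 := by
    intro l
    by_contra! hl
    have h0 : α l = 0 := Finsupp.ext hl
    have := hα l
    simp [h0] at this
  choose v hv using hex
  -- Choose one variable from each monomial, with the shared `j` chosen for both `i` and `k`. Fewer
  -- variables than monomials then generate a proper ideal containing them all.
  let w : ι → Fin s := fun l => if l = i ∨ l = k then j else v l
  have hw : ∀ l, α l (w l) ≠ 0 := by
    intro l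
    by_cases hl : l = i ∨ l = k
    · rw [show w l = j from if_pos hl]
      rcases hl with rfl | rfl
      · exact hj.1
      · exact hj.2
    · rw [show w l = v l from if_neg hl]
      exact hv l
  have hcard : (Finset.univ.image w).card < Fintype.card ι := by
    refine lt_of_le_of_ne Finset.card_image_le fun h => hik ?_
    exact Finset.card_image_iff.mp h (Finset.mem_coe.mpr (Finset.mem_univ i))
      (Finset.mem_coe.mpr (Finset.mem_univ k)) (by simp [w])
  set A : Finset (MvPolynomial (Fin s) K) := (Finset.univ.image w).image X
  have hle : Ideal.span (Set.range fun i => (monomial (α i) 1 : MvPolynomial (Fin s) K)) ≤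
      Ideal.span (A : Set (MvPolynomial (Fin s) K)) := by
    rw [Ideal.span_le]
    rintro _ ⟨l, rfl⟩
    have hX : (X (w l) : MvPolynomial (Fin s) K) ∣ monomial (α l) 1 :=
      X_dvd_monomial.mpr (Or.inr (hw l))
    refine Ideal.mem_of_dvd _ hX (Ideal.subset_span ?_)
    simp only [A, Finset.coe_image, Finset.coe_univ, Set.image_univ]
    exact ⟨w l, ⟨l, rfl⟩, rfl⟩
  have hne : Ideal.span (A : Set (MvPolynomial (Fin s) K)) ≠ ⊤ := by
    have h1 : Ideal.span (A : Set (MvPolynomial (Fin s) K)) ≤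
        RingHom.ker (constantCoeff (R := K) (σ := Fin s)) := by
      rw [Ideal.span_le]
      intro x hx
      simp only [A, Finset.coe_image, Finset.coe_univ, Set.image_univ] at hx
      obtain ⟨y, -, rfl⟩ := hx
      simp [RingHom.mem_ker]
    exact fun h => RingHom.ker_ne_top _ (top_le_iff.mp (h ▸ h1))
  have h1 := Ideal.height_mono hle
  have h2 := (Ideal.span (A : Set (MvPolynomial (Fin s) K))).height_le_spanFinrank hne
  have h3 := Submodule.spanFinrank_span_le_ncard_of_finite (R := MvPolynomial (Fin s) K)
    A.finite_toSet
  rw [Set.ncard_coe_finset] at h3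
  have h4 : A.card ≤ (Finset.univ.image w).card := Finset.card_image_le
  rw [hht] at h1
  have h5 : Fintype.card ι ≤ (Ideal.span (A : Set (MvPolynomial (Fin s) K))).spanFinrank := by
    exact_mod_cast h1.trans h2
  exact absurd (h5.trans (h3.trans h4)) (not_le.mpr hcard)

/-! ### Degrees and multiplication by a form -/

section Degree

variable {K : Type*} [Field K] {s : ℕ} {J : Ideal (MvPolynomial (Fin s) K)}

theorem hasDegree_of_eventually_eq (hdim : ringKrullDim (MvPolynomial (Fin s) K ⧸ J) = 1) {e : ℕ}
    (he : ∀ᶠ n in atTop, hilbertFunction J n = e) : HasDegree J e := by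
  refine Or.inr ⟨0, by simpa using hdim, ?_⟩
  refine tendsto_const_nhds.congr' ?_
  filter_upwards [he] with n hn
  simp [hn]

instance finite_homogeneousSubmodule (n : ℕ) : Module.Finite K (homogeneousSubmodule (Fin s) K n) :=
  Module.Finite.iff_fg.mpr (homogeneousSubmodule_fg (Fin s) K n)

theorem mem_of_hilbertFunction_eq_zero {n : ℕ} (h : hilbertFunction J n = 0)
    {p : MvPolynomial (Fin s) K} (hp : p.IsHomogeneous n) : p ∈ J := by
  rw [hilbertFunction, Module.finrank_zero_iff] at h
  have := Subsingleton.elim (α := homogeneousSubmodule (Fin s) K n ⧸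
    (J.restrictScalars K).comap (homogeneousSubmodule (Fin s) K n).subtype)
    (Submodule.Quotient.mk ⟨p, hp⟩) 0
  rwa [Submodule.Quotient.mk_eq_zero] at this

theorem homogeneousComponent_mul_of_isHomogeneous {f : MvPolynomial (Fin s) K} {d : ℕ}
    (hf : f.IsHomogeneous d) (c : MvPolynomial (Fin s) K) (n : ℕ) :
    homogeneousComponent (n + d) (c * f) = homogeneousComponent n c * f := by
  have : c * f = ∑ i ∈ Finset.range (c.totalDegree + 1), homogeneousComponent i c * f := by
    rw [← Finset.sum_mul, sum_homogeneousComponent]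
  rw [this, map_sum]
  have hterm : ∀ i, homogeneousComponent (n + d) (homogeneousComponent i c * f) =
      if n = i then homogeneousComponent n c * f else 0 := by
    intro i
    rw [homogeneousComponent_of_mem ((homogeneousComponent_isHomogeneous i c).mul hf)]
    by_cases h : n = i
    · simp [h]
    · rw [if_neg (by omega), if_neg h]
  simp_rw [hterm]
  rw [Finset.sum_ite_eq]
  split_ifs with hn
  · rfl
  · rw [homogeneousComponent_eq_zero n c (by simpa using hn), zero_mul]

/-- If the Hilbert function of `S / I` takes the same value at `n` and `n + d`, and multiplication
by `f` on `S / I` is not injective in degree `n`, then `S / (I, f)` is nonzero in degree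
`n + d`. -/
theorem hilbertFunction_sup_span_ne_zero (hJ : IsGraded J) {f g : MvPolynomial (Fin s) K}
    {d n : ℕ} (hf : f.IsHomogeneous d) (hg : g.IsHomogeneous n) (hgJ : g ∉ J) (hgf : g * f ∈ J)
    (hH : hilbertFunction J n = hilbertFunction J (n + d)) :
    hilbertFunction (J ⊔ Ideal.span {f}) (n + d) ≠ 0 := by
  intro h0
  set N := fun k => (J.restrictScalars K).comap (homogeneousSubmodule (Fin s) K k).subtype
  let μ : homogeneousSubmodule (Fin s) K n →ₗ[K] homogeneousSubmodule (Fin s) K (n + d) :=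
    (LinearMap.mulRight K f).restrict fun p hp => IsHomogeneous.mul hp hf
  have hμ : N n ≤ (N (n + d)).comap μ := fun p hp => J.mul_mem_right f hp
  let φ := (N n).mapQ (N (n + d)) μ hμ
  -- The vanishing of S/(I,f) in degree `n + d` is surjectivity of multiplication by `f`. Equal
  -- dimensions then force injectivity, which `g` refutes.
  have hsurj : Function.Surjective φ := by
    intro x
    obtain ⟨⟨p, hp⟩, rfl⟩ := (N (n + d)).mkQ_surjective x
    obtain ⟨a, ha, b, hb, hab⟩ := Submodule.mem_sup.mp (mem_of_hilbertFunction_eq_zero h0 hp)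
    obtain ⟨c, rfl⟩ := Ideal.mem_span_singleton'.mp hb
    refine ⟨(N n).mkQ ⟨homogeneousComponent n c, homogeneousComponent_mem n c⟩, ?_⟩
    rw [Submodule.mkQ_apply, Submodule.mapQ_apply, Submodule.mkQ_apply, Submodule.Quotient.eq]
    change homogeneousComponent n c * f - p ∈ J
    have h1 := congrArg (homogeneousComponent (n + d)) hab
    rw [map_add, homogeneousComponent_mul_of_isHomogeneous hf, homogeneousComponent_eq_self hp]
      at h1
    rw [← h1, sub_add_cancel_right]
    exact neg_mem (hJ a ha _)
  have hinj := (LinearMap.injective_iff_surjective_of_finrank_eq_finrank hH).mpr hsurj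
  have h1 : φ ((N n).mkQ ⟨g, hg⟩) = 0 := by
    rw [Submodule.mkQ_apply, Submodule.mapQ_apply, Submodule.Quotient.mk_eq_zero]
    exact hgf
  rw [← map_zero φ] at h1
  have h2 := hinj h1
  rw [Submodule.mkQ_apply, Submodule.Quotient.mk_eq_zero] at h2
  exact hgJ h2

end Degree

/-! ### Ideals whose initial ideal is a complete intersection -/

section InitialCompleteIntersection

variable {K : Type*} [Field K] {s r : ℕ} {m : MonomialOrder (Fin s)}
  {I : Ideal (MvPolynomial (Fin s) K)} {α : Fin r → Fin s →₀ ℕ}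

theorem exists_generators_of_standardExponents_eq (hstd : standardExponents m I = avoid α) :
    ∃ f : Fin r → MvPolynomial (Fin s) K,
      (∀ i, f i ≠ 0 ∧ m.degree (f i) = α i) ∧ I = Ideal.span (Set.range f) := by
  have h : ∀ i, ∃ p ∈ I, p ≠ 0 ∧ m.degree p = α i := by
    intro i
    have hi : α i ∉ standardExponents m I := by
      rw [hstd]
      exact fun h => h i le_rfl
    simpa [standardExponents] using hi
  choose f hfI hf0 hfα using h
  have hle : Ideal.span (Set.range f) ≤ I := by
    rw [Ideal.span_le]
    rintro _ ⟨i, rfl⟩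
    exact hfI i
  refine ⟨f, fun i => ⟨hf0 i, hfα i⟩, le_antisymm (fun p hp => ?_) hle⟩
  obtain ⟨q, hq, hs⟩ := exists_normalForm m (Ideal.span (Set.range f)) p
  have hqI : q ∈ I := by
    have := sub_mem hp (hle hq)
    rwa [sub_sub_cancel] at this
  have hq0 : q = 0 := by
    refine eq_zero_of_mem_of_support (m := m) hqI fun u hu => ?_
    rw [hstd]
    intro i hi
    rw [← hfα] at hi
    have hmem : f i ∈ Ideal.span (Set.range f) := Ideal.subset_span ⟨i, rfl⟩
    exact not_mem_standardExponents hmem (hf0 i) hi (hs u hu)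
  simpa [hq0] using hq

theorem zero_mem_avoid (hα : ∀ i, 1 ≤ (α i).degree) : 0 ∈ avoid α := by
  intro i hi
  have := hα i
  rw [nonpos_iff_eq_zero.mp hi] at this
  simp at this

/-- The leading monomial of the normal form of `h` has standard multiples in every higher degree,
because there are more variables than generators. -/
theorem monomial_mul_notMem (hs : r < s) (hstd : standardExponents m I = avoid α)
    {h : MvPolynomial (Fin s) K} (hh : h ∉ I) (k : ℕ) :
    ∃ b : Fin s →₀ ℕ, b.degree = k ∧ monomial b 1 * h ∉ I := by
  classical
  obtain ⟨q, hq, hsupp⟩ := exists_normalForm m I h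
  have hq0 : q ≠ 0 := by
    rintro rfl
    exact hh (by simpa using hq)
  have hu : m.degree q ∈ avoid α := hstd ▸ hsupp _ (m.degree_mem_support hq0)
  obtain ⟨v, huv, hv, hd⟩ := exists_mem_avoid_degree_eq (by simpa using hs) hu k
  refine ⟨v - m.degree q, ?_, fun hmem => ?_⟩
  · have := congrArg Finsupp.degree (tsub_add_cancel_of_le huv)
    rw [map_add, hd] at this
    omega
  · have hmon : monomial (v - m.degree q) (1 : K) ≠ 0 := by simp
    have h1 : monomial (v - m.degree q) 1 * q ∈ I := by
      have := sub_mem hmem (I.mul_mem_left (monomial (v - m.degree q) 1) hq)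
      rwa [mul_sub, sub_sub_cancel] at this
    refine not_mem_standardExponents h1 (mul_ne_zero hmon hq0) ?_ (hstd ▸ hv)
    rw [MonomialOrder.degree_mul hmon hq0, MonomialOrder.degree_monomial, if_neg one_ne_zero,
      tsub_add_cancel_of_le huv]

theorem infinite_of_degree_unbounded {σ : Type*} {V : Set (σ →₀ ℕ)}
    (h : ∀ n, ∃ u ∈ V, n ≤ u.degree) : V.Infinite := by
  intro hfin
  obtain ⟨B, hB⟩ := (hfin.image Finsupp.degree).bddAbove
  obtain ⟨u, hu, hd⟩ := h (B + 1)
  have := hB (Set.mem_image_of_mem _ hu)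
  omega

theorem isCompleteIntersection_and_ringKrullDim_eq_one (hs : s = r + 1)
    (hstd : standardExponents m I = avoid α)
    (hdisj : ∀ i k, i ≠ k → ∀ j, α i j = 0 ∨ α k j = 0) (hα : ∀ i, 1 ≤ (α i).degree) :
    IsCompleteIntersection I ∧ ringKrullDim (MvPolynomial (Fin s) K ⧸ I) = 1 := by
  have hinf : (standardExponents m I).Infinite := by
    refine infinite_of_degree_unbounded fun n => ?_
    obtain ⟨v, -, hv, hd⟩ := exists_mem_avoid_degree_eq (by simp [hs]) (zero_mem_avoid hα) n
    exact ⟨v, hstd ▸ hv, by simp [hd]⟩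
  have hlow := one_le_ringKrullDim_quotient hinf
  obtain ⟨f, hf, hspan⟩ := exists_generators_of_standardExponents_eq hstd
  have hdisj' : ∀ i k, i ≠ k → ∀ j, m.degree (f i) j = 0 ∨ m.degree (f k) j = 0 := by
    intro i k hik j
    rw [(hf i).2, (hf k).2]
    exact hdisj i k hik j
  have himg : f '' (Finset.univ : Finset (Fin r)) = Set.range f := by simp
  have hheight := card_le_height_span (fun i => (hf i).1) hdisj' Finset.univ
  have hdim := ringKrullDim_quotient_span_add_card_le (fun i => (hf i).1) hdisj' Finset.univ
  rw [himg, ← hspan, Finset.card_univ, Fintype.card_fin] at hheight hdim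
  have hne : I ≠ ⊤ := by
    rintro rfl
    rw [ringKrullDim_eq_bot_of_subsingleton] at hlow
    simp at hlow
  refine ⟨⟨r, f, hspan, le_antisymm ?_ hheight⟩, le_antisymm ?_ hlow⟩
  · refine (I.height_le_spanFinrank hne).trans ?_
    have h3 := Submodule.spanFinrank_span_le_ncard_of_finite (R := MvPolynomial (Fin s) K)
      (Set.finite_range f)
    rw [← Ideal.span, ← hspan] at h3
    have h4 : (Set.range f).ncard ≤ r := by
      rw [← Set.image_univ]
      refine (Set.ncard_image_le Set.finite_univ).trans ?_
      simp
    exact_mod_cast h3.trans h4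
  · clear hlow
    generalize ringKrullDim (MvPolynomial (Fin s) K ⧸ I) = x at hdim
    induction x using WithBot.recBotCoe with
    | bot => exact bot_le
    | coe y =>
      have h : y + r ≤ 1 + r := by
        rw [hs, add_comm r 1] at hdim
        exact_mod_cast hdim
      exact_mod_cast (ENat.add_le_add_iff_right (ENat.natCast_ne_top r)).mp h

theorem hilbertFunction_eq_countAvoid (hI : IsGraded I)
    (hstd : standardExponents m I = avoid α) (n : ℕ) :
    hilbertFunction I n = countAvoid α Finset.univ n := by
  rw [hilbertFunction_eq_card m hI, hstd, card_avoid_degree_eq]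

theorem hilbertFunction_eq_prod (hs : s = r + 1) (hI : IsGraded I)
    (hstd : standardExponents m I = avoid α)
    (hdisj : ∀ i k, i ≠ k → ∀ j, α i j = 0 ∨ α k j = 0) (hα : ∀ i, 1 ≤ (α i).degree) {n : ℕ}
    (hn : ∑ i, ((α i).degree - 1) ≤ n) : hilbertFunction I n = ∏ i, (α i).degree := by
  rw [hilbertFunction_eq_countAvoid hI hstd]
  have h1 := countAvoid_univ_eq_sum_coeff hdisj (by simp [hs]) n
  rw [sum_coeff_geomProd hα hn] at h1
  exact_mod_cast h1

theorem hasRegularity (hs : s = r + 1) (hI : IsGraded I)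
    (hstd : standardExponents m I = avoid α)
    (hdisj : ∀ i k, i ≠ k → ∀ j, α i j = 0 ∨ α k j = 0) (hα : ∀ i, 1 ≤ (α i).degree) :
    HasRegularity I (∑ i, ((α i).degree - 1)) := by
  have hprod := fun n => hilbertFunction_eq_prod (n := n) hs hI hstd hdisj hα
  refine ⟨Polynomial.C ((∏ i, (α i).degree : ℕ) : ℚ), ?_, ?_, fun n hn => ?_⟩
  · filter_upwards [eventually_ge_atTop (∑ i, ((α i).degree - 1))] with n hn
    rw [hprod n hn, Polynomial.eval_C]
  · intro n hn
    rw [hprod n hn, Polynomial.eval_C]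
  · by_contra hlt
    have hlt' := not_le.mp hlt
    obtain ⟨k, hk⟩ : ∃ k, k + 1 = ∑ i, ((α i).degree - 1) := ⟨_, Nat.sub_add_cancel (by omega)⟩
    have h1 := hn k (by omega)
    rw [Polynomial.eval_C] at h1
    have h2 : hilbertFunction I k = ∏ i, (α i).degree := by exact_mod_cast h1
    have h3 := countAvoid_univ_eq_sum_coeff hdisj (by simp [hs]) k
    rw [sum_coeff_geomProd_of_succ_eq hα hk, ← hilbertFunction_eq_countAvoid hI hstd, h2] at h3
    push_cast at h3
    omega

/-- The degree of `S / (I, f)` for a homogeneous zero divisor `f` of `S / I`. -/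
theorem exists_hasDegree_sup_span_singleton (hs : s = r + 1) (hI : IsGraded I)
    (hstd : standardExponents m I = avoid α)
    (hdisj : ∀ i k, i ≠ k → ∀ j, α i j = 0 ∨ α k j = 0) (hα : ∀ i, 1 ≤ (α i).degree)
    {f : MvPolynomial (Fin s) K} {d : ℕ} (hf : f.IsHomogeneous d) (hfI : f ∉ I)
    (hzd : IsZeroDivisorMod I f) :
    ∃ e, e < ∏ i, (α i).degree ∧ HasDegree (I ⊔ Ideal.span {f}) e ∧
      ∀ᶠ n in atTop, hilbertFunction (I ⊔ Ideal.span {f}) n = e := by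
  have hJ := isGraded_sup_span_singleton hI hf
  have hle := standardExponents_antitone (m := m) (le_sup_left : I ≤ I ⊔ Ideal.span {f})
  obtain ⟨e, he⟩ := exists_eventually_card_degree_eq hdisj (by simp [hs])
    (isLowerSet_standardExponents (m := m) (J := I ⊔ Ideal.span {f})) (hle.trans hstd.subset)
  have hprod := fun n => hilbertFunction_eq_prod (n := n) hs hI hstd hdisj hα
  set ρ := ∑ i, ((α i).degree - 1)
  have he' : ∀ᶠ n in atTop, hilbertFunction (I ⊔ Ideal.span {f}) n = e := by
    filter_upwards [he] with n hn
    rw [hilbertFunction_eq_card m hJ, hn]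
  have hdim : ringKrullDim (MvPolynomial (Fin s) K ⧸ I ⊔ Ideal.span {f}) = 1 := by
    refine le_antisymm ?_ (one_le_ringKrullDim_quotient (m := m)
      (infinite_of_degree_unbounded fun n => ?_))
    · rw [← (isCompleteIntersection_and_ringKrullDim_eq_one hs hstd hdisj hα).2]
      exact ringKrullDim_le_of_surjective (Ideal.Quotient.factor le_sup_left)
        (Ideal.Quotient.factor_surjective _)
    · obtain ⟨h, hhI, hhf⟩ := hzd
      obtain ⟨a, ha⟩ : ∃ a, homogeneousComponent a h ∉ I := by
        by_contra! hall
        exact hhI (sum_homogeneousComponent h ▸ I.sum_mem fun a _ => hall a)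
      have haf : homogeneousComponent a h * f ∈ I := by
        rw [← homogeneousComponent_mul_of_isHomogeneous hf]
        exact hI _ hhf _
      -- The shift by `ρ` reaches the range where the Hilbert function of `I` is constant; the shift
      -- by `n` makes the degrees unbounded.
      obtain ⟨b, hb, hbI⟩ := monomial_mul_notMem (by omega) hstd ha (n + ρ)
      have hne := hilbertFunction_sup_span_ne_zero hI hf
        ((isHomogeneous_monomial (1 : K) hb).mul (homogeneousComponent_isHomogeneous a h)) hbI
        (by rw [mul_assoc]; exact I.mul_mem_left _ haf)
        (by rw [hprod _ (by omega), hprod _ (by omega)])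
      rw [hilbertFunction_eq_card m hJ] at hne
      obtain ⟨⟨u, hu, hd⟩⟩ := (Nat.card_ne_zero.mp hne).1
      exact ⟨u, hu, by omega⟩
  refine ⟨e, ?_, hasDegree_of_eventually_eq hdim he', he'⟩
  obtain ⟨n₀, hn₀⟩ := eventually_atTop.mp he
  -- In this degree both Hilbert functions are constant. The normal form of t^b·f lies in (I,f), and
  -- its leading exponent is standard for I but not for (I,f), so the inequality is strict.
  obtain ⟨b, hb, hbI⟩ := monomial_mul_notMem (by omega) hstd hfI (n₀ + ρ)
  obtain ⟨g, -, hg, hgs⟩ := exists_homogeneous_normalForm m hI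
    ((isHomogeneous_monomial (1 : K) hb).mul hf)
  have hg0 : g ≠ 0 := by
    rintro rfl
    exact hbI (by simpa using hg)
  have hgJ : g ∈ I ⊔ Ideal.span {f} := by
    have := sub_mem (Ideal.mul_mem_left _ (monomial b (1 : K))
      (Ideal.mem_sup_right (Ideal.mem_span_singleton_self f))) (Ideal.mem_sup_left hg)
    rwa [sub_sub_cancel] at this
  obtain ⟨hu, hud⟩ := hgs _ (m.degree_mem_support hg0)
  have hlt := card_degree_lt hle hu (not_mem_standardExponents hgJ hg0 le_rfl) hud
  rwa [hn₀ _ (by omega), ← hilbertFunction_eq_card m hI, hprod _ (by omega)] at hlt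

end InitialCompleteIntersection
-- From zero-divisors of S/I to those of S/in(I)
section ZeroDivisors

variable {K : Type*} [Field K] {s r : ℕ} {m : MonomialOrder (Fin s)}
  {I : Ideal (MvPolynomial (Fin s) K)} {α : Fin r → Fin s →₀ ℕ} {d : ℕ}

theorem isHomogeneous_of_mem_standardZeroDivPolys {f : MvPolynomial (Fin s) K}
    (hf : f ∈ standardZeroDivPolys m I d) : f.IsHomogeneous d := by
  intro u hu
  have h := (hf.2.1 u (mem_support_iff.mpr hu)).2
  rwa [Finsupp.degree_eq_weight_one] at h

theorem notMem_of_mem_standardZeroDivPolys {f : MvPolynomial (Fin s) K}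
    (hf : f ∈ standardZeroDivPolys m I d) : f ∉ I := fun h =>
  hf.1 (eq_zero_of_mem_of_support (m := m) h fun u hu =>
    (footprint_eq (m := m) (J := I)).subset (hf.2.1 u hu).1)

/-- A witness `h` for `f` may be replaced by its normal form `q`; then in(q) is standard while
in(q)·in(f) = in(qf) lies in in(I). -/
theorem degree_mem_standardZeroDivMonomials {f : MvPolynomial (Fin s) K}
    (hf : f ∈ standardZeroDivPolys m I d) : m.degree f ∈ standardZeroDivMonomials m I d := by
  obtain ⟨h, hhI, hhf⟩ := hf.2.2
  obtain ⟨ha, hd⟩ := hf.2.1 _ (m.degree_mem_support hf.1)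
  refine ⟨ha, hd, ?_⟩
  obtain ⟨q, hq, hs⟩ := exists_normalForm m I h
  have hq0 : q ≠ 0 := by
    rintro rfl
    exact hhI (by simpa using hq)
  have hqf : q * f ∈ I := by
    have := sub_mem hhf (I.mul_mem_right f hq)
    rwa [sub_mul, sub_sub_cancel] at this
  refine ⟨monomial (m.degree q) 1, ?_, ?_⟩
  · rw [monomial_mem_initialIdeal_iff, not_not]
    exact hs _ (m.degree_mem_support hq0)
  · rw [monomial_mul, one_mul, monomial_mem_initialIdeal_iff,
      ← MonomialOrder.degree_mul hq0 hf.1]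
    exact not_mem_standardExponents hqf (mul_ne_zero hq0 hf.1) le_rfl

/-- The Hilbert function of `S / (I, f)` is bounded by that of `S / (in(I), in(f))`. -/
theorem hilbertFunction_sup_span_le (hI : IsGraded I)
    (hgen : initialIdeal m I =
      Ideal.span (Set.range fun i => (monomial (α i) 1 : MvPolynomial (Fin s) K)))
    {f : MvPolynomial (Fin s) K} (hf : f.IsHomogeneous d) (h0 : f ≠ 0) (n : ℕ) :
    hilbertFunction (I ⊔ Ideal.span {f}) n ≤
      hilbertFunction (initialIdeal m I ⊔ Ideal.span {monomial (m.degree f) 1}) n := by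
  have hmon : initialIdeal m I ⊔ Ideal.span {monomial (m.degree f) 1} =
      Ideal.span (Set.range fun i : Option (Fin r) =>
        (monomial (i.elim (m.degree f) α) 1 : MvPolynomial (Fin s) K)) := by
    rw [hgen, ← Ideal.span_union]
    congr 1
    ext x
    simp [Option.exists, eq_comm]
  rw [hmon, hilbertFunction_eq_card m (isGraded_sup_span_singleton hI hf),
    hilbertFunction_eq_card m (isGraded_span_monomial _), standardExponents_span_monomial]
  refine card_degree_mono (fun u hu i hi => ?_) n
  cases i with
  | none =>
    exact not_mem_standardExponents
      (Ideal.mem_sup_right (Ideal.mem_span_singleton_self f)) h0 hi hu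
  | some i =>
    have h1 : (monomial u 1 : MvPolynomial (Fin s) K) ∈ initialIdeal m I := by
      rw [hgen, monomial_mem_span_monomial_iff]
      exact ⟨i, hi⟩
    exact monomial_mem_initialIdeal_iff.mp h1 (standardExponents_antitone le_sup_left hu)

end ZeroDivisors
end FootprintCI

/-! ### Proof of the proposition -/

open FootprintCI in
theorem mainTheorem7 {K : Type*} [Field K] (s : ℕ) (hs : 2 ≤ s)
    (m : MonomialOrder (Fin s)) (hm : IsGradedOrder m)
    (I : Ideal (MvPolynomial (Fin s) K)) (hI : IsGraded I)
    -- the exponents of the `s - 1` generators of the initial ideal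
    (α : Fin (s - 1) → (Fin s →₀ ℕ))
    (hα : ∀ i, 1 ≤ (α i).degree)
    (hgen : initialIdeal m I =
      Ideal.span (Set.range fun i => (monomial (α i) 1 : MvPolynomial (Fin s) K)))
    (hht : (initialIdeal m I).height = ((s - 1 : ℕ) : ℕ∞)) :
    -- (a)
    (IsCompleteIntersection I ∧ ringKrullDim (MvPolynomial (Fin s) K ⧸ I) = 1) ∧
    -- (b)
    (HasDegree I (∏ i, (α i).degree) ∧ HasRegularity I (∑ i, ((α i).degree - 1))) ∧
    -- (c), preceded by the facts that all degrees and maxima involved exist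
    (∀ d : ℕ, 1 ≤ d →
      (∀ a ∈ standardZeroDivMonomials m I d,
        ∃ e, HasDegree (initialIdeal m I ⊔ Ideal.span {monomial a 1}) e) ∧
      (∀ f ∈ standardZeroDivPolys m I d, ∃ e, HasDegree (I ⊔ Ideal.span {f}) e) ∧
      BddAbove (footprintDegrees m I d) ∧ BddAbove (minDistDegrees m I d) ∧
      1 ≤ fp m I d ∧ fp m I d ≤ minDist m I d) := by
  have hs' : s = s - 1 + 1 := by omega
  have hdisj := disjoint_of_height_eq hα (by rw [← hgen, hht, Fintype.card_fin])
  have hstd : standardExponents m I = avoid α := by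
    ext u
    rw [← not_iff_not, ← monomial_mem_initialIdeal_iff (K := K), hgen,
      monomial_mem_span_monomial_iff]
    simp [avoid]
  have hprod := fun n => hilbertFunction_eq_prod (n := n) hs' hI hstd hdisj hα
  have ha := isCompleteIntersection_and_ringKrullDim_eq_one hs' hstd hdisj hα
  have hdeg : HasDegree I (∏ i, (α i).degree) :=
    hasDegree_of_eventually_eq ha.2 (eventually_atTop.mpr ⟨_, hprod⟩)
  refine ⟨ha, ⟨hdeg, hasRegularity hs' hI hstd hdisj hα⟩, fun d _ => ?_⟩
  have hM : ∀ a ∈ standardZeroDivMonomials m I d, ∃ e, e < ∏ i, (α i).degree ∧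
      HasDegree (initialIdeal m I ⊔ Ideal.span {monomial a 1}) e ∧
      ∀ᶠ n in atTop,
        hilbertFunction (initialIdeal m I ⊔ Ideal.span {monomial a 1}) n = e := by
    rintro a ⟨haI, had, haz⟩
    -- The result is applied with in(I) in place of `I`: it is graded and has the same standard
    -- monomials.
    refine exists_hasDegree_sup_span_singleton (m := m) hs' ?_ ?_ hdisj hα
      (isHomogeneous_monomial 1 had) haI haz
    · rw [hgen]
      exact isGraded_span_monomial α
    · rw [hgen]
      exact standardExponents_span_monomial α
  have hF : ∀ f ∈ standardZeroDivPolys m I d, ∃ e, e < ∏ i, (α i).degree ∧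
      HasDegree (I ⊔ Ideal.span {f}) e ∧
      ∀ᶠ n in atTop, hilbertFunction (I ⊔ Ideal.span {f}) n = e := fun f hf =>
    exists_hasDegree_sup_span_singleton hs' hI hstd hdisj hα
      (isHomogeneous_of_mem_standardZeroDivPolys hf) (notMem_of_mem_standardZeroDivPolys hf)
      hf.2.2
  have hbM : BddAbove (footprintDegrees m I d) := by
    refine ⟨∏ i, (α i).degree, ?_⟩
    rintro _ ⟨a, ha, rfl⟩
    obtain ⟨e, he, hde, -⟩ := hM a ha
    exact hde.degree_eq ▸ he.le
  have hbF : BddAbove (minDistDegrees m I d) := by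
    refine ⟨∏ i, (α i).degree, ?_⟩
    rintro _ ⟨f, hf, rfl⟩
    obtain ⟨e, he, hde, -⟩ := hF f hf
    exact hde.degree_eq ▸ he.le
  have hpos : 1 ≤ ∏ i, (α i).degree := Finset.one_le_prod' fun i _ => hα i
  refine ⟨fun a ha => (hM a ha).imp fun _ h => h.2.1, fun f hf => (hF f hf).imp fun _ h => h.2.1,
    hbM, hbF, ?_, ?_⟩
  · rw [fp, hdeg.degree_eq]
    split_ifs with hne
    · obtain ⟨a, ha⟩ := hne
      obtain ⟨a', ha', hmax⟩ := Nat.sSup_mem (s := footprintDegrees m I d) ⟨_, a, ha, rfl⟩ hbM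
      obtain ⟨e, he, hde, -⟩ := hM a' ha'
      rw [hmax, hde.degree_eq]
      omega
    · exact_mod_cast hpos
  · rw [minDist]
    split_ifs with hne
    · obtain ⟨f, hf⟩ := hne
      rw [fp, if_pos ⟨_, degree_mem_standardZeroDivMonomials hf⟩]
      obtain ⟨f', hf', hmax⟩ := Nat.sSup_mem (s := minDistDegrees m I d) ⟨_, f, hf, rfl⟩ hbF
      have hf'M := degree_mem_standardZeroDivMonomials hf'
      obtain ⟨e, -, hde, hev⟩ := hF f' hf'
      obtain ⟨e', -, hde', hev'⟩ := hM _ hf'M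
      -- In one common large degree both Hilbert functions equal the degrees, so the pointwise bound
      -- compares the degrees.
      obtain ⟨n, hn, hn'⟩ := (hev.and hev').exists
      have hle := hilbertFunction_sup_span_le hI hgen
        (isHomogeneous_of_mem_standardZeroDivPolys hf') hf'.1 n
      have hsup := le_csSup hbM ⟨_, hf'M, rfl⟩
      rw [hn, hn'] at hle
      rw [hde'.degree_eq] at hsup
      rw [hmax, hde.degree_eq]
      omega
    -- Here δ is the full degree of S/I, from which fp subtracts a natural number or nothing.
    · rw [fp]
      split_ifs <;> omega
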